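/- Let $m \ge 2$ be a fixed integer. For each $d$, let $W_d$ be a random real $m \times m$ matrix following the standard real Wishart distribution $\mathcal{W}_m(I_m, d)$, i.e. the distribution of $\sum_{k=1}^{d} G_k G_k^{T}$ with $G_1, \ldots, G_d$ independent random vectors in $\mathbb{R}^m$, each with the Gaussian distribution $\mathcal{N}_m(0, I_m)$. Let $\lambda_1 \ge \lambda_2 \ge \cdots \ge \lambda_m$ be the ordered eigenvalues of $W_d$, counted with multiplicity. Then for every constant $C > 0$, $$\mathbb{P}\left(\min_{1 \le k \le m-1} (\lambda_k - \lambda_{k+1}) > C\right) \longrightarrow 1 \qquad \text{as } d \to \infty .$$ -/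

import Mathlib

open MeasureTheory ProbabilityTheory Filter
open scoped Topology Matrix

/-- The product sigma-algebra on real matrices: generated by the entries. -/
noncomputable instance matrixMeasurableSpace {m n : ℕ} :
    MeasurableSpace (Matrix (Fin m) (Fin n) ℝ) :=
  inferInstanceAs (MeasurableSpace (Fin m → Fin n → ℝ))

/-- The real Wishart distribution `W_m(S, d)`: the law of `∑ k, G_k G_kᵀ`, where `G_1, …, G_d` are
i.i.d. random vectors with the centred Gaussian distribution on `ℝ^m` with covariance matrix `S`
(`S` positive semidefinite). The standard one is the case `S = 1`. -/
noncomputable def wishartMeasure {m : ℕ} (S : Matrix (Fin m) (Fin m) ℝ) (d : ℕ) :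
    Measure (Matrix (Fin m) (Fin m) ℝ) :=
  (Measure.pi (fun _ : Fin d => multivariateGaussian (0 : EuclideanSpace ℝ (Fin m)) S)).map
    (fun G : Fin d → EuclideanSpace ℝ (Fin m) =>
      ∑ k : Fin d, Matrix.vecMulVec (G k).ofLp (G k).ofLp)

/-- The eigenvalues of a real symmetric `m × m` matrix, with multiplicity, in decreasing order
`lam 0 ≥ lam 1 ≥ … ≥ lam (m - 1)`. -/
noncomputable def orderedEigenvalues {m : ℕ} {A : Matrix (Fin m) (Fin m) ℝ}
    (hA : A.IsHermitian) : Fin m → ℝ :=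
  fun k => hA.eigenvalues₀ (Fin.cast (Fintype.card_fin m).symm k)

/-- The minimum gap between consecutive eigenvalues (with multiplicity) of a real symmetric `m × m`
matrix. For `2 ≤ m` the infimum is over a finite nonempty family, hence it is the minimum. -/
noncomputable def minEigengap {m : ℕ} {A : Matrix (Fin m) (Fin m) ℝ} (hA : A.IsHermitian) : ℝ :=
  ⨅ k : Fin (m - 1), (orderedEigenvalues hA ⟨k, by omega⟩ - orderedEigenvalues hA ⟨k + 1, by omega⟩)

/-! By the central limit theorem `(W_d - d I) / √d` converges in law to a Gaussian symmetric matrix.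
Centring preserves eigenvalue gaps and scaling divides them by `√d`, so a gap of at most `C` becomes
a gap of at most `C / √d`, and it is enough that the limit almost surely has simple spectrum, in a
form that passes to weak limits.

The Krylov determinant supplies that form. If `A = U D Uᵀ` with `U` orthogonal, it is `det U` times
the product of the entries of `Uᵀ 1` times the Vandermonde determinant of the eigenvalues. Hence a
small gap forces it to be small relative to a power of `1 + ‖A‖²` (`krylovRatio_center_le`), yet it
is polynomial in the entries of `A`, so no continuity or measurability of eigenvalues is needed. It
vanishes on a null set for the limit law (`ae_det_krylov_symmetrize_ne_zero`), so the open sets `δ <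
krylovRatio` have limit mass close to 1 for small `δ`. The portmanteau theorem, with
`tendsto_normalizedLaw`, concludes. -/

/-! ### Krylov determinants and eigenvalue gaps -/

/-- The Krylov matrix `[1, A 1, A² 1, …]` of a square matrix, started at the all-ones vector. -/
def krylov {m : ℕ} {R : Type*} [CommRing R] (A : Matrix (Fin m) (Fin m) R) :
    Matrix (Fin m) (Fin m) R :=
  Matrix.of fun i j => ((A ^ (j : ℕ)) *ᵥ (1 : Fin m → R)) i

lemma krylov_diagonal {m : ℕ} {R : Type*} [CommRing R] (v : Fin m → R) :
    krylov (Matrix.diagonal v) = Matrix.vandermonde v := by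
  ext i j
  simp [krylov, Matrix.diagonal_pow, Matrix.mulVec_diagonal, Matrix.vandermonde_apply]

lemma krylov_smul {m : ℕ} {R : Type*} [CommRing R] (c : R) (A : Matrix (Fin m) (Fin m) R) :
    krylov (c • A) = krylov A * Matrix.diagonal (fun j : Fin m => c ^ (j : ℕ)) := by
  ext i j
  simp [krylov, smul_pow, Matrix.smul_mulVec, mul_comm]

lemma krylov_map {m : ℕ} {R S : Type*} [CommRing R] [CommRing S] (f : R →+* S)
    (A : Matrix (Fin m) (Fin m) R) : (krylov A).map f = krylov (A.map f) := by
  ext i j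
  have h2 : (A ^ (j : ℕ)).map f = (A.map f) ^ (j : ℕ) := by
    simpa using map_pow f.mapMatrix A (j : ℕ)
  simp only [krylov, Matrix.map_apply, Matrix.of_apply]
  rw [RingHom.map_mulVec, h2]
  congr 2
  ext; simp

lemma conj_diagonal_pow {m : ℕ} {R : Type*} [CommRing R] {U : Matrix (Fin m) (Fin m) R}
    (hU : Uᵀ * U = 1) (v : Fin m → R) (k : ℕ) :
    (U * Matrix.diagonal v * Uᵀ) ^ k = U * Matrix.diagonal (v ^ k) * Uᵀ := by
  induction k with
  | zero => simp [mul_eq_one_comm.1 hU]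
  | succ k ih =>
    rw [pow_succ, ih]
    calc _ = U * Matrix.diagonal (v ^ k) * (Uᵀ * U) * Matrix.diagonal v * Uᵀ := by
          simp only [Matrix.mul_assoc]
      _ = _ := by
          rw [hU, Matrix.mul_one, Matrix.mul_assoc U, Matrix.diagonal_mul_diagonal, pow_succ]
          rfl

/-- Column `j` is `U D^j (Uᵀ 1)`, and a diagonal matrix applied to a vector is symmetric in the two,
which exposes the Vandermonde matrix. -/
lemma krylov_conj_diagonal {m : ℕ} {R : Type*} [CommRing R] {U : Matrix (Fin m) (Fin m) R}
    (hU : Uᵀ * U = 1) (v : Fin m → R) :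
    krylov (U * Matrix.diagonal v * Uᵀ) =
      U * (Matrix.diagonal (Uᵀ *ᵥ 1) * Matrix.vandermonde v) := by
  ext i j
  simp only [krylov, Matrix.of_apply]
  rw [conj_diagonal_pow hU, ← Matrix.mulVec_mulVec, ← Matrix.mulVec_mulVec]
  simp only [Matrix.mul_apply, Matrix.mulVec, dotProduct, Matrix.diagonal_apply,
    Matrix.vandermonde_apply]
  refine Finset.sum_congr rfl fun x _ => ?_
  simp [mul_comm]

lemma sum_sq_conj_diagonal {m : ℕ} {U : Matrix (Fin m) (Fin m) ℝ}
    (hU : Uᵀ * U = 1) (v : Fin m → ℝ) :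
    ∑ i, ∑ j, ((U * Matrix.diagonal v * Uᵀ) i j) ^ 2 = ∑ i, v i ^ 2 := by
  set A := U * Matrix.diagonal v * Uᵀ with hA
  have hT : Aᵀ = A := by simp [hA, Matrix.transpose_mul, Matrix.mul_assoc]
  have h1 : ∑ i, ∑ j, (A i j) ^ 2 = (A ^ 2).trace := by
    rw [sq, Matrix.trace]
    simp only [Matrix.diag_apply, Matrix.mul_apply]
    refine Finset.sum_congr rfl fun i _ => Finset.sum_congr rfl fun j _ => ?_
    rw [sq]; congr 1
    exact congrFun (congrFun hT j) i
  rw [h1, hA, conj_diagonal_pow hU, Matrix.mul_assoc, Matrix.trace_mul_comm, Matrix.mul_assoc, hU]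
  simp [Matrix.trace]

lemma trace_conj_diagonal {m : ℕ} {U : Matrix (Fin m) (Fin m) ℝ}
    (hU : Uᵀ * U = 1) (v : Fin m → ℝ) :
    (U * Matrix.diagonal v * Uᵀ).trace = ∑ i, v i := by
  rw [Matrix.mul_assoc, Matrix.trace_mul_comm, Matrix.mul_assoc, hU]
  simp [Matrix.trace]

lemma abs_entry_le_one {m : ℕ} {U : Matrix (Fin m) (Fin m) ℝ} (hU : Uᵀ * U = 1) (i j : Fin m) :
    |U i j| ≤ 1 := by
  have h : ∑ k, U k j * U k j = 1 := by
    simpa [Matrix.mul_apply] using congrFun (congrFun hU j) j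
  have := Finset.single_le_sum (f := fun k => U k j * U k j)
    (fun k _ => mul_self_nonneg _) (Finset.mem_univ i)
  rw [h] at this
  exact abs_le_one_iff_mul_self_le_one.2 this

/-- In the product of differences, keep the factor of the pair `a, b` and bound every other one by
`q`. -/
lemma abs_det_vandermonde_le {m : ℕ} {v : Fin m → ℝ} {q : ℝ} (hq : 1 ≤ q)
    (hv : ∀ i j, |v i - v j| ≤ q) {a b : Fin m} (hab : a ≠ b) :
    |(Matrix.vandermonde v).det| ≤
      |v a - v b| * q ^ (Finset.univ.sigma fun i : Fin m => Finset.Ioi i).card := by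
  wlog h : a < b generalizing a b
  · rw [abs_sub_comm]
    exact this hab.symm (lt_of_le_of_ne (not_lt.1 h) hab.symm)
  rw [Matrix.det_vandermonde, Finset.prod_sigma', Finset.abs_prod,
    ← Finset.mul_prod_erase (a := (⟨a, b⟩ : (_ : Fin m) × Fin m)) _ _ (by simpa using h),
    abs_sub_comm]
  gcongr
  calc _ ≤ q ^ ((Finset.univ.sigma fun i : Fin m => Finset.Ioi i).erase ⟨a, b⟩).card :=
        (Finset.prod_le_prod (fun i _ => abs_nonneg _) fun i _ => hv _ _).trans_eq (by simp)
    _ ≤ _ := pow_le_pow_right₀ hq (Finset.card_le_card (Finset.erase_subset _ _))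

/-- Each entry of `Uᵀ 1` is at most `m` in absolute value, which gives `m ^ m`. With `s` the sum of
squared entries, equal to `∑ v i ^ 2`, each `|v i|` is at most `1 + s`, so differences are at most
`2 (1 + s)`. -/
lemma abs_det_krylov_conj_diagonal_le {m : ℕ} {U : Matrix (Fin m) (Fin m) ℝ} (hU : Uᵀ * U = 1)
    (v : Fin m → ℝ) {a b : Fin m} (hab : a ≠ b) :
    |(krylov (U * Matrix.diagonal v * Uᵀ)).det| ≤ (m : ℝ) ^ m * (|v a - v b| *
      (2 * (1 + ∑ i, ∑ j, ((U * Matrix.diagonal v * Uᵀ) i j) ^ 2)) ^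
        (Finset.univ.sigma fun i : Fin m => Finset.Ioi i).card) := by
  rw [krylov_conj_diagonal hU, sum_sq_conj_diagonal hU]
  set s := ∑ i, v i ^ 2
  have hs0 : 0 ≤ s := Finset.sum_nonneg fun i _ => sq_nonneg _
  have hvs : ∀ i, |v i| ≤ 1 + s := fun i => by
    have : v i ^ 2 ≤ s := Finset.single_le_sum (f := fun i => v i ^ 2)
      (fun k _ => sq_nonneg _) (Finset.mem_univ i)
    rw [abs_le]
    constructor <;> nlinarith [sq_nonneg (v i + 1), sq_nonneg (v i - 1)]
  have hdet : |U.det| = 1 := by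
    have := congrArg Matrix.det hU
    rw [Matrix.det_mul, Matrix.det_transpose, Matrix.det_one] at this
    exact abs_eq (zero_le_one) |>.2 (mul_self_eq_one_iff.1 this)
  rw [Matrix.det_mul, Matrix.det_mul, Matrix.det_diagonal, abs_mul, abs_mul, hdet, one_mul,
    Finset.abs_prod]
  refine mul_le_mul ?_ (abs_det_vandermonde_le (by linarith) (fun i j => ?_) hab)
    (abs_nonneg _) (by positivity)
  · refine (Finset.prod_le_prod (g := fun _ => (m : ℝ)) (fun i _ => abs_nonneg _)
      fun i _ => ?_).trans_eq (by simp)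
    simp only [Matrix.mulVec, dotProduct, Matrix.transpose_apply, Pi.one_apply, mul_one]
    refine (Finset.abs_sum_le_sum_abs _ _).trans
      ((Finset.sum_le_card_nsmul _ _ 1 fun j _ => abs_entry_le_one hU j i).trans_eq (by simp))
  · linarith [abs_sub (v i) (v j), hvs i, hvs j]

lemma Matrix.IsHermitian.exists_conj_diagonal {m : ℕ} {A : Matrix (Fin m) (Fin m) ℝ}
    (hA : A.IsHermitian) : ∃ U : Matrix (Fin m) (Fin m) ℝ, Uᵀ * U = 1 ∧
      A = U * Matrix.diagonal hA.eigenvalues * Uᵀ ∧ ∀ i j, U i j = hA.eigenvectorBasis j i := by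
  refine ⟨hA.eigenvectorUnitary, ?_, ?_, fun i j => rfl⟩
  · have := (Matrix.mem_unitaryGroup_iff' (A := (hA.eigenvectorUnitary :
      Matrix (Fin m) (Fin m) ℝ))).1 hA.eigenvectorUnitary.2
    simpa [Matrix.star_eq_conjTranspose] using this
  · have := hA.spectral_theorem
    simpa [Unitary.conjStarAlgAut_apply, Matrix.star_eq_conjTranspose] using this

lemma exists_eigenvalues_sub_le {m : ℕ} (hm : 2 ≤ m) {A : Matrix (Fin m) (Fin m) ℝ}
    (hA : A.IsHermitian) {C : ℝ} (h : minEigengap hA ≤ C) :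
    ∃ a b, a ≠ b ∧ |hA.eigenvalues a - hA.eigenvalues b| ≤ C := by
  have : Nonempty (Fin (m - 1)) := ⟨⟨0, by omega⟩⟩
  obtain ⟨k, hk⟩ := exists_eq_ciInf_of_finite (f := fun k : Fin (m - 1) =>
    orderedEigenvalues hA ⟨k, by omega⟩ - orderedEigenvalues hA ⟨k + 1, by omega⟩)
  rw [minEigengap, ← hk] at h
  -- This is the reindexing through which `eigenvalues` is defined from the sorted `eigenvalues₀`.
  let e : Fin (Fintype.card (Fin m)) ≃ Fin m := Fintype.equivOfCardEq (Fintype.card_fin _)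
  have he : ∀ x, hA.eigenvalues (e x) = hA.eigenvalues₀ x := fun x => by
    simp [Matrix.IsHermitian.eigenvalues, e]
  refine ⟨e (Fin.cast (Fintype.card_fin m).symm ⟨k, by omega⟩),
    e (Fin.cast (Fintype.card_fin m).symm ⟨k + 1, by omega⟩), ?_, ?_⟩
  · intro hh
    have := e.injective hh
    simp [Fin.ext_iff] at this
  · rw [he, he, abs_of_nonneg]
    · exact h
    · exact sub_nonneg.2 (hA.eigenvalues₀_antitone (by simp [Fin.le_def]))

/-! ### Almost sure nonvanishing for Gaussian symmetric matrices -/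

/-- A vector of `ℝ^(m × m)` seen as a matrix. -/
def toMat {m : ℕ} (z : EuclideanSpace ℝ (Fin m × Fin m)) : Matrix (Fin m) (Fin m) ℝ :=
  Matrix.of fun i j => z (i, j)

lemma toMat_apply {m : ℕ} (z : EuclideanSpace ℝ (Fin m × Fin m)) (i j : Fin m) :
    toMat z i j = z (i, j) := rfl

lemma continuous_toMat {m : ℕ} :
    Continuous (toMat : EuclideanSpace ℝ (Fin m × Fin m) → Matrix (Fin m) (Fin m) ℝ) := by
  refine continuous_matrix fun i j => ?_
  simp only [toMat_apply]
  fun_prop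

lemma continuous_det_krylov {m : ℕ} :
    Continuous fun A : Matrix (Fin m) (Fin m) ℝ => (krylov A).det := by
  refine Continuous.matrix_det (continuous_matrix fun i j => ?_)
  simp only [krylov, Matrix.of_apply]
  exact (continuous_apply i).comp
    ((continuous_id.pow (j : ℕ)).matrix_mulVec continuous_const)

/-- The Krylov determinant is not identically zero along a line in a direction where it is nonzero,
hence vanishes at only finitely many points of the line. -/
lemma finite_det_krylov_line {m : ℕ} (A V : Matrix (Fin m) (Fin m) ℝ) (hV : (krylov V).det ≠ 0) :
    {t : ℝ | (krylov (A + t • V)).det = 0}.Finite := by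
  let N : Matrix (Fin m) (Fin m) (Polynomial ℝ) :=
    A.map Polynomial.C + (Polynomial.X : Polynomial ℝ) • V.map Polynomial.C
  have heval : ∀ t : ℝ, (krylov N).det.eval t = (krylov (A + t • V)).det := fun t => by
    have h1 : N.map (Polynomial.evalRingHom t) = A + t • V := by
      ext i j
      simp [N, mul_comm t]
    rw [← Polynomial.coe_evalRingHom, RingHom.map_det, RingHom.mapMatrix_apply, krylov_map, h1]
  have hne : (krylov N).det ≠ 0 := by
    -- By homogeneity, the determinant at `A + t V` is a power of `t` times the one at `t⁻¹ A + V`,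
    -- which tends to the nonzero value at `V`.
    have hlim : Tendsto (fun t : ℝ => (krylov (t⁻¹ • A + V)).det) atTop (𝓝 (krylov V).det) := by
      refine (continuous_det_krylov.tendsto V).comp ?_
      have : Tendsto (fun t : ℝ => t⁻¹ • A + V) atTop (𝓝 ((0 : ℝ) • A + V)) :=
        (tendsto_inv_atTop_zero.smul_const A).add_const V
      simpa using this
    obtain ⟨t, ht, ht0⟩ := ((hlim.eventually_ne hV).and (eventually_gt_atTop 0)).exists
    intro h0
    have h1 := heval t
    have h2 : A + t • V = t • (t⁻¹ • A + V) := by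
      rw [smul_add, smul_smul, mul_inv_cancel₀ ht0.ne', one_smul]
    rw [h0, Polynomial.eval_zero, h2, krylov_smul, Matrix.det_mul, Matrix.det_diagonal] at h1
    exact mul_ne_zero ht (Finset.prod_ne_zero_iff.2 fun j _ => pow_ne_zero _ ht0.ne') h1.symm
  refine ((krylov N).det.roots.toFinset.finite_toSet).subset fun t ht => ?_
  simp only [Finset.mem_coe, Multiset.mem_toFinset, Polynomial.mem_roots hne, Polynomial.IsRoot.def]
  rw [heval]
  exact ht

lemma MeasureTheory.Measure.AbsolutelyContinuous.pi_fin : ∀ {n : ℕ} {μ ν : Fin n → Measure ℝ}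
    [∀ i, SigmaFinite (μ i)] [∀ i, SigmaFinite (ν i)], (∀ i, μ i ≪ ν i) →
    Measure.pi μ ≪ Measure.pi ν
  | 0, μ, ν, _, _, _ => by
    rw [Measure.pi_of_empty μ, Measure.pi_of_empty ν]
  | n + 1, μ, ν, _, _, h => by
    have hμ := (measurePreserving_piFinSuccAbove μ 0).symm
    have hν := (measurePreserving_piFinSuccAbove ν 0).symm
    rw [← hμ.map_eq, ← hν.map_eq]
    exact ((h 0).prod (pi_fin fun i => h _)).map hμ.measurable

lemma stdGaussian_absolutelyContinuous {ι : Type*} [Fintype ι] :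
    stdGaussian (EuclideanSpace ℝ ι) ≪ volume := by
  have h : (Measure.pi fun _ : Fin (Module.finrank ℝ (EuclideanSpace ℝ ι)) => gaussianReal 0 1) ≪
      volume := Measure.AbsolutelyContinuous.pi_fin fun _ =>
        gaussianReal_absolutelyContinuous 0 one_ne_zero
  have h2 := (stdOrthonormalBasis ℝ (EuclideanSpace ℝ ι)).measurePreserving_repr_symm
  have h3 := h2.comp (PiLp.volume_preserving_toLp
    (Fin (Module.finrank ℝ (EuclideanSpace ℝ ι))))
  have h4 : stdGaussian (EuclideanSpace ℝ ι) = (Measure.pi fun _ => gaussianReal 0 1).map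
      ((stdOrthonormalBasis ℝ (EuclideanSpace ℝ ι)).repr.symm ∘ WithLp.toLp 2) := by
    rw [stdGaussian]
    congr 1
    ext1 x
    simp [← OrthonormalBasis.sum_repr_symm]
  rw [← h3.map_eq, h4]
  exact h.map h3.measurable

/-- `z ↦ c (z + zᵀ) / 2`. -/
noncomputable def symmetrize {m : ℕ} (c : ℝ) (z : EuclideanSpace ℝ (Fin m × Fin m)) :
    EuclideanSpace ℝ (Fin m × Fin m) :=
  WithLp.toLp 2 fun p => c * ((z p + z p.swap) / 2)

lemma symmetrize_apply {m : ℕ} (c : ℝ) (z : EuclideanSpace ℝ (Fin m × Fin m))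
    (p : Fin m × Fin m) : symmetrize c z p = c * ((z p + z p.swap) / 2) := rfl

lemma continuous_symmetrize {m : ℕ} (c : ℝ) : Continuous (symmetrize (m := m) c) := by
  unfold symmetrize
  fun_prop

/-- Fubini along lines parallel to a direction where the determinant is nonzero: each line meets the
zero set in finitely many points, so that set is Lebesgue null, hence Gaussian null. -/
lemma ae_det_krylov_symmetrize_ne_zero {m : ℕ} {c : ℝ} (hc : c ≠ 0) :
    ∀ᵐ z ∂(stdGaussian (EuclideanSpace ℝ (Fin m × Fin m))),
      (krylov (toMat (symmetrize c z))).det ≠ 0 := by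
  refine stdGaussian_absolutelyContinuous.ae_le ?_
  -- The direction is `diag(0, …, m - 1)`, whose Krylov matrix is the Vandermonde matrix at distinct
  -- nodes.
  let v : EuclideanSpace ℝ (Fin m × Fin m) :=
    WithLp.toLp 2 fun p => if p.1 = p.2 then (p.1 : ℝ) else 0
  have hv : toMat (symmetrize c v) = c • Matrix.diagonal (fun i : Fin m => (i : ℝ)) := by
    ext i j
    by_cases hij : i = j
    · subst hij; simp [toMat_apply, symmetrize_apply, v]
    · simp [toMat_apply, symmetrize_apply, v, hij, Ne.symm hij]
  have hV : (krylov (toMat (symmetrize c v))).det ≠ 0 := by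
    rw [hv, krylov_smul, krylov_diagonal, Matrix.det_mul, Matrix.det_diagonal]
    refine mul_ne_zero (Matrix.det_vandermonde_ne_zero_iff.2 fun i j h => ?_)
      (Finset.prod_ne_zero_iff.2 fun j _ => pow_ne_zero _ hc)
    exact Fin.ext (by exact_mod_cast h)
  have hs : MeasurableSet {z : EuclideanSpace ℝ (Fin m × Fin m) |
      (krylov (toMat (symmetrize c z))).det ≠ 0} :=
    (isOpen_ne.preimage (continuous_det_krylov.comp
      (continuous_toMat.comp (continuous_symmetrize c)))).measurableSet
  refine ae_mem_of_ae_add_linearMap_mem (LinearMap.toSpanSingleton ℝ _ v)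
    (volume : Measure ℝ) volume hs fun y => ?_
  have hfin := finite_det_krylov_line (toMat (symmetrize c y)) _ hV
  refine (measure_eq_zero_iff_ae_notMem.1 (hfin.measure_zero volume)).mono fun t ht => ?_
  have : toMat (symmetrize c (y + t • v)) = toMat (symmetrize c y) + t • toMat (symmetrize c v) := by
    ext i j
    simp [toMat_apply, symmetrize_apply]
    ring
  change (krylov (toMat (symmetrize c (y + t • v)))).det ≠ 0
  rw [this]
  exact ht

/-! ### Central limit theorem by characteristic functions -/

section CentralLimit

variable {α E : Type*} [MeasurableSpace α] [NormedAddCommGroup E] [InnerProductSpace ℝ E]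
  [MeasurableSpace E] [BorelSpace E] [SecondCountableTopology E]

lemma charFun_map_normalized_sum (γ : Measure α) [IsProbabilityMeasure γ] {X : α → E}
    (hX : Measurable X) (d : ℕ) (t : E) :
    charFun ((Measure.pi fun _ : Fin d => γ).map fun G => (√d)⁻¹ • ∑ k, X (G k)) t =
      charFun (γ.map fun g => inner ℝ (X g) t) ((√d)⁻¹) ^ d := by
  rw [charFun_apply, integral_map (Measurable.aemeasurable (by fun_prop))
    (Measurable.aestronglyMeasurable (by fun_prop)), charFun_apply_real,
    integral_map (Measurable.aemeasurable (by fun_prop))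
    (Measurable.aestronglyMeasurable (by fun_prop))]
  have h := integral_fintype_prod_eq_pow (ι := Fin d) (μ := γ)
    (fun g => Complex.exp (((√d)⁻¹ : ℝ) * (inner ℝ (X g) t : ℝ) * Complex.I))
  rw [Fintype.card_fin] at h
  rw [← h]
  congr 1
  ext G
  rw [← Complex.exp_sum, real_inner_smul_left, sum_inner, Complex.ofReal_mul, Complex.ofReal_sum,
    Finset.mul_sum, Finset.sum_mul]

lemma tendsto_charFun_map_normalized_sum (γ : Measure α) [IsProbabilityMeasure γ] {X : α → E}
    (hX : Measurable X) (t : E) (hmean : ∫ g, inner ℝ (X g) t ∂γ = 0)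
    (hint : Integrable (fun g => (inner ℝ (X g) t) ^ 2) γ) :
    Tendsto (fun d : ℕ =>
      charFun ((Measure.pi fun _ : Fin d => γ).map fun G => (√d)⁻¹ • ∑ k, X (G k)) t) atTop
      (𝓝 (Complex.exp (-(∫ g, (inner ℝ (X g) t) ^ 2 ∂γ : ℝ) / 2))) := by
  simp_rw [charFun_map_normalized_sum γ hX]
  set Y : α → ℝ := fun g => inner ℝ (X g) t with hYdef
  have hY : Measurable Y := by fun_prop
  set v : ℝ := ∫ g, Y g ^ 2 ∂γ with hv
  have hv0 : 0 ≤ v := integral_nonneg fun g => sq_nonneg _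
  rcases hv0.eq_or_lt with h0 | hpos
  -- Zero variance must be allowed: it occurs here for antisymmetric `t`.
  · have hY0 : Y =ᵐ[γ] fun _ => 0 := by
      have := (integral_eq_zero_iff_of_nonneg (fun g => sq_nonneg (Y g)) hint).1 (hv ▸ h0.symm)
      filter_upwards [this] with g hg
      simpa using hg
    rw [Measure.map_congr hY0, ← h0]
    simp
  · have hs : √v ≠ 0 := (Real.sqrt_pos.2 hpos).ne'
    have hY' : Measurable fun g => (√v)⁻¹ * Y g := by fun_prop
    -- The one-dimensional theorem is for unit variance: apply it to `Y / √v` at the point `√v`.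
    have key := tendsto_charFun_inv_sqrt_mul_pow (P := γ) hY'.aemeasurable
      (by rw [integral_const_mul]; simp [hmean]) (by
        simp only [Pi.pow_apply, mul_pow]
        rw [integral_const_mul, ← hv, inv_pow, Real.sq_sqrt hv0, inv_mul_cancel₀ hpos.ne']) (√v)
    simp_rw [charFun_map_mul_comp hY.aemeasurable] at key
    convert key using 3
    · rw [mul_comm (√_)⁻¹ (√v), ← mul_assoc, inv_mul_cancel₀ hs, one_mul]
    · rw [← Complex.ofReal_pow, Real.sq_sqrt hv0]

end CentralLimit

/-! ### Moments of `g gᵀ - 1` -/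

/-- The variance of the square of a standard Gaussian variable. -/
noncomputable def gaussianSqVar : ℝ := Var[fun x => x ^ 2; gaussianReal 0 1]

lemma memLp_sq_gaussianReal : MemLp (fun x : ℝ => x ^ 2) 2 (gaussianReal 0 1) := by
  have := (memLp_id_gaussianReal' (μ := 0) (v := 1) 4 (by simp)).norm_rpow_div 2
  have h4 : (4 : ENNReal) / 2 = 2 := by
    rw [show (4 : ENNReal) = 2 * 2 by norm_num]
    exact ENNReal.mul_div_cancel_right (by simp) (by simp)
  rw [h4] at this
  simpa using this

lemma integral_sq_gaussianReal : ∫ x, x ^ 2 ∂(gaussianReal 0 1) = 1 := by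
  have h := variance_of_integral_eq_zero (μ := gaussianReal 0 1) (X := fun x => x)
    (by fun_prop) (by simp)
  rw [variance_fun_id_gaussianReal] at h
  simpa using h.symm

/-- Zero variance would force `x ^ 2 = 1` almost surely, but the Gaussian law has no atoms. Only
positivity of this constant matters, not its value. -/
lemma gaussianSqVar_pos : 0 < gaussianSqVar := by
  refine lt_of_le_of_ne (variance_nonneg _ _) fun h => ?_
  have h1 := ae_eq_integral_of_variance_eq_zero memLp_sq_gaussianReal h.symm
  have : NullSingletonClass (gaussianReal 0 1) := nullSingletonClass_gaussianReal one_ne_zero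
  have h2 : ∀ᵐ x ∂(gaussianReal 0 1), x ∉ ({1, -1} : Set ℝ) :=
    measure_eq_zero_iff_ae_notMem.1 ((Set.toFinite _).measure_zero _)
  obtain ⟨x, hx1, hx2⟩ := (h1.and h2).exists
  rw [integral_sq_gaussianReal] at hx1
  exact hx2 (by simpa using hx1)

/-- The entries of the centred rank-one matrix `g gᵀ - 1`. -/
noncomputable def centredOuter {m : ℕ} (g : EuclideanSpace ℝ (Fin m)) :
    EuclideanSpace ℝ (Fin m × Fin m) :=
  WithLp.toLp 2 fun p => g p.1 * g p.2 - if p.1 = p.2 then 1 else 0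

lemma centredOuter_apply {m : ℕ} (g : EuclideanSpace ℝ (Fin m)) (p : Fin m × Fin m) :
    centredOuter g p = g p.1 * g p.2 - if p.1 = p.2 then 1 else 0 := rfl

lemma continuous_centredOuter {m : ℕ} : Continuous (centredOuter (m := m)) := by
  unfold centredOuter
  fun_prop

/-- Pairing with a symmetric matrix only sees the symmetric part of `t`. -/
lemma inner_centredOuter {m : ℕ} (g : EuclideanSpace ℝ (Fin m))
    (t : EuclideanSpace ℝ (Fin m × Fin m)) :
    inner ℝ (centredOuter g) t = g.ofLp ⬝ᵥ (toMat (symmetrize 1 t)) *ᵥ g.ofLp -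
      (toMat (symmetrize 1 t)).trace := by
  have h1 : inner ℝ (centredOuter g) t = ∑ i, ∑ j, g i * t (i, j) * g j - ∑ i, t (i, i) := by
    simp only [PiLp.inner_apply, RCLike.inner_apply, conj_trivial, centredOuter_apply, mul_sub,
      Finset.sum_sub_distrib, Fintype.sum_prod_type]
    congr 1
    · exact Finset.sum_congr rfl fun i _ => Finset.sum_congr rfl fun j _ => by ring
    · simp
  have h2 : ∑ i, ∑ j, g i * t (i, j) * g j = ∑ i, ∑ j, g i * t (j, i) * g j := by
    rw [Finset.sum_comm]
    exact Finset.sum_congr rfl fun i _ => Finset.sum_congr rfl fun j _ => by ring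
  have h3 : g.ofLp ⬝ᵥ (toMat (symmetrize 1 t)) *ᵥ g.ofLp =
      (∑ i, ∑ j, g i * t (i, j) * g j + ∑ i, ∑ j, g i * t (j, i) * g j) / 2 := by
    simp only [dotProduct, Matrix.mulVec, toMat_apply, symmetrize_apply, Prod.swap_prod_mk,
      Finset.mul_sum, ← Finset.sum_add_distrib, Finset.sum_div]
    exact Finset.sum_congr rfl fun i _ => Finset.sum_congr rfl fun j _ => by ring
  rw [h1, h3, ← h2]
  simp [Matrix.trace, toMat_apply, symmetrize_apply]

lemma norm_sq_eq_sum_toMat {m : ℕ} (z : EuclideanSpace ℝ (Fin m × Fin m)) :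
    ‖z‖ ^ 2 = ∑ i, ∑ j, (toMat z i j) ^ 2 := by
  rw [EuclideanSpace.real_norm_sq_eq, Fintype.sum_prod_type]
  rfl

lemma isHermitian_toMat_symmetrize {m : ℕ} (c : ℝ) (z : EuclideanSpace ℝ (Fin m × Fin m)) :
    (toMat (symmetrize c z)).IsHermitian := by
  ext i j
  simp [toMat_apply, symmetrize_apply, add_comm]

/-- Under the standard Gaussian measure, `⟪g gᵀ - 1, t⟫` is a linear combination of centred squares
of independent standard Gaussian variables. -/
lemma exists_map_inner_centredOuter {m : ℕ} (t : EuclideanSpace ℝ (Fin m × Fin m)) :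
    ∃ w : Fin m → ℝ, ∑ i, w i ^ 2 = ‖symmetrize 1 t‖ ^ 2 ∧
      (stdGaussian (EuclideanSpace ℝ (Fin m))).map (fun g => inner ℝ (centredOuter g) t) =
      (Measure.pi fun _ : Fin m => gaussianReal 0 1).map
        (fun x => (∑ i, fun x : Fin m → ℝ => w i * (x i ^ 2 - 1)) x) := by
  obtain ⟨U, hU, hS, hUb⟩ := (isHermitian_toMat_symmetrize 1 t).exists_conj_diagonal
  generalize (isHermitian_toMat_symmetrize 1 t).eigenvalues = w at hS
  generalize (isHermitian_toMat_symmetrize 1 t).eigenvectorBasis = b at hUb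
  refine ⟨w, ?_, ?_⟩
  · rw [norm_sq_eq_sum_toMat, hS, sum_sq_conj_diagonal hU]
  -- Rotation invariance: the Gaussian vector is generated in an eigenbasis of the symmetric part of
  -- `t`, where the quadratic form is diagonal.
  rw [stdGaussian_eq_map_pi_orthonormalBasis b, Measure.map_map
    (continuous_centredOuter.inner continuous_const).measurable (by fun_prop)]
  congr 1
  ext x
  have hx : (∑ i, x i • b i).ofLp = U *ᵥ x := by
    ext j
    simp [Matrix.mulVec, dotProduct, hUb, mul_comm]
  simp only [Function.comp_apply]
  rw [inner_centredOuter, hx, hS, trace_conj_diagonal hU, Matrix.mulVec_mulVec, Matrix.mul_assoc,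
    hU, Matrix.mul_one, ← Matrix.mulVec_mulVec, Matrix.dotProduct_mulVec, Matrix.vecMul_mulVec,
    hU, Matrix.vecMul_one]
  simp only [dotProduct, Matrix.mulVec_diagonal, Finset.sum_apply, ← Finset.sum_sub_distrib]
  exact Finset.sum_congr rfl fun i _ => by ring

lemma inner_centredOuter_moments {m : ℕ} (t : EuclideanSpace ℝ (Fin m × Fin m)) :
    ∫ g, inner ℝ (centredOuter g) t ∂(stdGaussian (EuclideanSpace ℝ (Fin m))) = 0 ∧
    Integrable (fun g => (inner ℝ (centredOuter g) t) ^ 2)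
      (stdGaussian (EuclideanSpace ℝ (Fin m))) ∧
    ∫ g, (inner ℝ (centredOuter g) t) ^ 2 ∂(stdGaussian (EuclideanSpace ℝ (Fin m))) =
      gaussianSqVar * ‖symmetrize 1 t‖ ^ 2 := by
  obtain ⟨w, hw, hmap⟩ := exists_map_inner_centredOuter t
  set γ := stdGaussian (EuclideanSpace ℝ (Fin m))
  set π := Measure.pi fun _ : Fin m => gaussianReal 0 1
  set Q : (Fin m → ℝ) → ℝ := ∑ i, fun x : Fin m → ℝ => w i * (x i ^ 2 - 1) with hQ
  set Y : EuclideanSpace ℝ (Fin m) → ℝ := fun g => inner ℝ (centredOuter g) t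
  have hYm : Measurable Y := (continuous_centredOuter.inner continuous_const).measurable
  have hQm : Measurable Q := by
    have : Q = fun x => ∑ i, w i * (x i ^ 2 - 1) := by ext x; simp [hQ]
    rw [this]
    fun_prop
  have hLp : ∀ i, MemLp (fun x : ℝ => w i * (x ^ 2 - 1)) 2 (gaussianReal 0 1) := fun i =>
    (memLp_sq_gaussianReal.sub (memLp_const 1)).const_mul (w i)
  have hLpi : ∀ i, MemLp (fun x : Fin m → ℝ => w i * (x i ^ 2 - 1)) 2 π := fun i =>
    (hLp i).comp_measurePreserving (measurePreserving_eval (fun _ : Fin m => gaussianReal 0 1) i)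
  have hQLp : MemLp Q 2 π := memLp_finsetSum' _ fun i _ => hLpi i
  have hQ0 : ∫ x, Q x ∂π = 0 := by
    simp only [hQ, Finset.sum_apply]
    rw [integral_finsetSum _ fun i _ => (hLpi i).integrable (by norm_num)]
    refine Finset.sum_eq_zero fun i _ => ?_
    have := integral_comp_eval (μ := fun _ : Fin m => gaussianReal 0 1) (i := i)
      (hLp i).aestronglyMeasurable
    rw [this, integral_const_mul, integral_sub (memLp_sq_gaussianReal.integrable (by norm_num))
      (integrable_const _), integral_sq_gaussianReal]
    simp
  have hQv : ∫ x, Q x ^ 2 ∂π = gaussianSqVar * ∑ i, w i ^ 2 := by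
    rw [← variance_of_integral_eq_zero hQm.aemeasurable hQ0, hQ, variance_sum_pi hLp,
      Finset.mul_sum]
    refine Finset.sum_congr rfl fun i _ => ?_
    rw [variance_const_mul, variance_sub_const (by fun_prop), gaussianSqVar, mul_comm]
  have e1 : ∫ g, Y g ∂γ = ∫ x, Q x ∂π := by
    have h1 := integral_map hYm.aemeasurable (μ := γ) (f := fun y : ℝ => y) (by fun_prop)
    have h2 := integral_map hQm.aemeasurable (μ := π) (f := fun y : ℝ => y) (by fun_prop)
    rw [← h1, hmap]
    exact h2
  have e2 : ∫ g, Y g ^ 2 ∂γ = ∫ x, Q x ^ 2 ∂π := by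
    have h1 := integral_map hYm.aemeasurable (μ := γ) (f := fun y : ℝ => y ^ 2) (by fun_prop)
    have h2 := integral_map hQm.aemeasurable (μ := π) (f := fun y : ℝ => y ^ 2) (by fun_prop)
    rw [← h1, hmap]
    exact h2
  refine ⟨e1.trans hQ0, ?_, by rw [e2, hQv, hw]⟩
  have h1 := integrable_map_measure (μ := γ) (g := fun y : ℝ => y ^ 2) (by fun_prop)
    hYm.aemeasurable
  have h2 := integrable_map_measure (μ := π) (g := fun y : ℝ => y ^ 2) (by fun_prop)
    hQm.aemeasurable
  exact h1.1 (by rw [hmap]; exact h2.2 hQLp.integrable_sq)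

/-! ### Weak convergence of the normalised matrices -/

/-- The weak limit of the normalised centred Wishart distributions. -/
noncomputable def limitLaw (m : ℕ) : ProbabilityMeasure (EuclideanSpace ℝ (Fin m × Fin m)) :=
  ⟨(stdGaussian _).map (symmetrize √gaussianSqVar),
    Measure.isProbabilityMeasure_map (continuous_symmetrize _).measurable.aemeasurable⟩

lemma inner_symmetrize_left {m : ℕ} (c : ℝ) (z t : EuclideanSpace ℝ (Fin m × Fin m)) :
    inner ℝ (symmetrize c z) t = inner ℝ z (symmetrize c t) := by
  simp only [PiLp.inner_apply, RCLike.inner_apply, conj_trivial, symmetrize_apply]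
  have h : ∑ p : Fin m × Fin m, t p * z p.swap = ∑ p : Fin m × Fin m, t p.swap * z p :=
    Fintype.sum_equiv (Equiv.prodComm _ _) _ _ fun p => by simp
  calc _ = c / 2 * (∑ p, t p * z p + ∑ p : Fin m × Fin m, t p * z p.swap) := by
        rw [← Finset.sum_add_distrib, Finset.mul_sum]
        exact Finset.sum_congr rfl fun p _ => by ring
    _ = _ := by
        rw [h, ← Finset.sum_add_distrib, Finset.mul_sum]
        exact Finset.sum_congr rfl fun p _ => by ring

lemma symmetrize_eq_smul {m : ℕ} (c : ℝ) (z : EuclideanSpace ℝ (Fin m × Fin m)) :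
    symmetrize c z = c • symmetrize 1 z := by
  ext p
  simp [symmetrize_apply]

lemma charFun_limitLaw {m : ℕ} (t : EuclideanSpace ℝ (Fin m × Fin m)) :
    charFun (limitLaw m : Measure (EuclideanSpace ℝ (Fin m × Fin m))) t =
      Complex.exp (-(gaussianSqVar * ‖symmetrize 1 t‖ ^ 2 : ℝ) / 2) := by
  change charFun ((stdGaussian _).map (symmetrize √gaussianSqVar)) t = _
  rw [charFun_apply, integral_map (continuous_symmetrize _).measurable.aemeasurable
    (Measurable.aestronglyMeasurable (by fun_prop))]
  simp_rw [inner_symmetrize_left]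
  rw [← charFun_apply, charFun_stdGaussian, symmetrize_eq_smul, norm_smul,
    ← Complex.ofReal_pow, mul_pow, Real.norm_eq_abs, sq_abs, Real.sq_sqrt gaussianSqVar_pos.le]

/-- The law of the normalised centred Wishart matrix. -/
noncomputable def normalizedLaw (m d : ℕ) :
    ProbabilityMeasure (EuclideanSpace ℝ (Fin m × Fin m)) :=
  ⟨(Measure.pi fun _ : Fin d => stdGaussian (EuclideanSpace ℝ (Fin m))).map
      fun G => (√d)⁻¹ • ∑ k, centredOuter (G k),
    Measure.isProbabilityMeasure_map (by
      have := (continuous_centredOuter (m := m)).measurable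
      exact Measurable.aemeasurable (by fun_prop))⟩

lemma tendsto_normalizedLaw (m : ℕ) :
    Tendsto (normalizedLaw m) atTop (𝓝 (limitLaw m)) := by
  refine ProbabilityMeasure.tendsto_iff_tendsto_charFun.2 fun t => ?_
  obtain ⟨h0, h1, h2⟩ := inner_centredOuter_moments t
  rw [charFun_limitLaw, ← h2]
  exact tendsto_charFun_map_normalized_sum _ continuous_centredOuter.measurable t h0 h1

/-! ### A continuous substitute for the eigenvalue gap -/

/-- A lower bound, up to a constant, for the eigenvalue gaps of a symmetric matrix: the normalised
absolute value of its Krylov determinant. -/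
noncomputable def krylovRatio {m : ℕ} (e : EuclideanSpace ℝ (Fin m × Fin m)) : ℝ :=
  |(krylov (toMat e)).det| /
    (1 + ‖e‖ ^ 2) ^ (Finset.univ.sigma fun i : Fin m => Finset.Ioi i).card

lemma continuous_krylovRatio {m : ℕ} : Continuous (krylovRatio (m := m)) := by
  unfold krylovRatio
  refine (continuous_det_krylov.comp continuous_toMat).abs.div (by fun_prop) fun e => ?_
  positivity

/-- The entries of `(A - d I) / √d`. -/
noncomputable def center {m : ℕ} (d : ℕ) (A : Matrix (Fin m) (Fin m) ℝ) :
    EuclideanSpace ℝ (Fin m × Fin m) :=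
  WithLp.toLp 2 fun p => (√d)⁻¹ * (A p.1 p.2 - d * if p.1 = p.2 then 1 else 0)

lemma measurable_matrix_apply {m : ℕ} (i j : Fin m) :
    Measurable fun A : Matrix (Fin m) (Fin m) ℝ => A i j :=
  (measurable_pi_apply (X := fun _ : Fin m => ℝ) j).comp
    (measurable_pi_apply (X := fun _ : Fin m => Fin m → ℝ) i)

lemma measurable_center {m : ℕ} (d : ℕ) : Measurable (center (m := m) d) := by
  unfold center
  refine (WithLp.measurable_toLp 2 _).comp (measurable_pi_lambda _ fun p => ?_)
  exact ((measurable_matrix_apply p.1 p.2).sub_const _).const_mul _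

lemma toMat_center {m : ℕ} (d : ℕ) (A : Matrix (Fin m) (Fin m) ℝ) :
    toMat (center d A) = (√d)⁻¹ • (A - (d : ℝ) • (1 : Matrix (Fin m) (Fin m) ℝ)) := by
  ext i j
  simp [toMat_apply, center, Matrix.one_apply]

lemma krylovRatio_center_le {m : ℕ} (hm : 2 ≤ m) {d : ℕ} {A : Matrix (Fin m) (Fin m) ℝ}
    (hA : A.IsHermitian) {C : ℝ} (h : minEigengap hA ≤ C) :
    krylovRatio (center d A) ≤
      (m : ℝ) ^ m * 2 ^ (Finset.univ.sigma fun i : Fin m => Finset.Ioi i).card * C * (√d)⁻¹ := by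
  obtain ⟨a, b, hab, hle⟩ := exists_eigenvalues_sub_le hm hA h
  obtain ⟨U, hU, hS, -⟩ := hA.exists_conj_diagonal
  generalize hA.eigenvalues = w at hS hle
  have hB : toMat (center d A) = U * Matrix.diagonal (fun i => (√d)⁻¹ * (w i - d)) * Uᵀ := by
    have h1 : Matrix.diagonal (fun i => (√d)⁻¹ * (w i - d)) =
        (√d)⁻¹ • (Matrix.diagonal w - (d : ℝ) • (1 : Matrix (Fin m) (Fin m) ℝ)) := by
      ext i j
      by_cases hij : i = j
      · subst hij; simp
      · simp [hij]
    rw [toMat_center, h1, hS, Matrix.mul_smul, Matrix.smul_mul, Matrix.mul_sub, Matrix.sub_mul,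
      Matrix.mul_smul, Matrix.smul_mul, Matrix.mul_one, mul_eq_one_comm.1 hU]
  have key := abs_det_krylov_conj_diagonal_le hU (fun i => (√d)⁻¹ * (w i - d)) hab
  rw [← hB, ← norm_sq_eq_sum_toMat] at key
  rw [krylovRatio, div_le_iff₀ (by positivity)]
  refine key.trans ?_
  have hgap : |(√d)⁻¹ * (w a - d) - (√d)⁻¹ * (w b - d)| ≤ (√d)⁻¹ * C := by
    rw [← mul_sub, sub_sub_sub_cancel_right, abs_mul, abs_of_nonneg (by positivity)]
    gcongr
  calc _ ≤ (m : ℝ) ^ m * ((√d)⁻¹ * C * (2 * (1 + ‖center d A‖ ^ 2)) ^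
        (Finset.univ.sigma fun i : Fin m => Finset.Ioi i).card) := by gcongr
    _ = _ := by rw [mul_pow]; ring

/-! ### The Wishart law and the conclusion -/

lemma measurable_sum_vecMulVec {m d : ℕ} :
    Measurable fun G : Fin d → EuclideanSpace ℝ (Fin m) =>
      ∑ k : Fin d, Matrix.vecMulVec (G k).ofLp (G k).ofLp := by
  refine measurable_pi_lambda _ fun i => measurable_pi_lambda _ fun j => ?_
  have : (fun G : Fin d → EuclideanSpace ℝ (Fin m) =>
      (∑ k : Fin d, Matrix.vecMulVec (G k).ofLp (G k).ofLp) i j) =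
      fun G => ∑ k : Fin d, G k i * G k j := by
    ext G
    simp [Matrix.sum_apply, Matrix.vecMulVec_apply]
  rw [this]
  fun_prop

lemma isProbabilityMeasure_wishartMeasure {m : ℕ} (S : Matrix (Fin m) (Fin m) ℝ) (d : ℕ) :
    IsProbabilityMeasure (wishartMeasure S d) :=
  Measure.isProbabilityMeasure_map measurable_sum_vecMulVec.aemeasurable

lemma ae_isHermitian_wishartMeasure {m : ℕ} (S : Matrix (Fin m) (Fin m) ℝ) (d : ℕ) :
    ∀ᵐ A ∂(wishartMeasure S d), ∀ i j, A i j = A j i := by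
  rw [wishartMeasure, ae_map_iff measurable_sum_vecMulVec.aemeasurable]
  · refine Eventually.of_forall fun G i j => ?_
    simp [Matrix.sum_apply, Matrix.vecMulVec_apply, mul_comm]
  · simp only [Set.ofPred_forall]
    exact MeasurableSet.iInter fun i => MeasurableSet.iInter fun j =>
      measurableSet_eq_fun (measurable_matrix_apply i j) (measurable_matrix_apply j i)

lemma wishartMeasure_map_center (m d : ℕ) :
    (wishartMeasure (1 : Matrix (Fin m) (Fin m) ℝ) d).map (center d) = normalizedLaw m d := by
  rw [wishartMeasure, multivariateGaussian_zero_one,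
    Measure.map_map (measurable_center d) measurable_sum_vecMulVec]
  change _ = Measure.map _ _
  congr 1
  ext G p
  simp only [Function.comp_apply, center, PiLp.smul_apply, WithLp.ofLp_sum, Finset.sum_apply,
    centredOuter_apply, Matrix.sum_apply, Matrix.vecMulVec_apply, smul_eq_mul,
    Finset.sum_sub_distrib]
  simp

lemma limitLaw_krylovRatio_pos (m : ℕ) :
    (limitLaw m : Measure (EuclideanSpace ℝ (Fin m × Fin m))) {e | 0 < krylovRatio e} = 1 := by
  have hs : MeasurableSet {e : EuclideanSpace ℝ (Fin m × Fin m) | 0 < krylovRatio e} :=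
    (isOpen_lt continuous_const continuous_krylovRatio).measurableSet
  rw [prob_compl_eq_zero_iff hs |>.symm]
  change ∀ᵐ e ∂((stdGaussian _).map (symmetrize √gaussianSqVar)), 0 < krylovRatio e
  rw [ae_map_iff (continuous_symmetrize _).measurable.aemeasurable hs]
  filter_upwards [ae_det_krylov_symmetrize_ne_zero (m := m)
    (Real.sqrt_pos.2 gaussianSqVar_pos).ne'] with z hz
  exact div_pos (abs_pos.2 hz) (by positivity)

/-- Continuity from below along `δ = 1 / (n + 1)`, whose sets increase to an event of mass 1. -/
lemma exists_lt_limitLaw_krylovRatio (m : ℕ) {a : ENNReal} (ha : a < 1) :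
    ∃ δ : ℝ, 0 < δ ∧
      a < (limitLaw m : Measure (EuclideanSpace ℝ (Fin m × Fin m))) {e | δ < krylovRatio e} := by
  have hU : {e : EuclideanSpace ℝ (Fin m × Fin m) | 0 < krylovRatio e} =
      ⋃ n : ℕ, {e | 1 / ((n : ℝ) + 1) < krylovRatio e} := by
    ext e
    simp only [Set.mem_ofPred_eq, Set.mem_iUnion]
    exact ⟨exists_nat_one_div_lt, fun ⟨n, hn⟩ => lt_trans (by positivity) hn⟩
  have hmono : Monotone fun n : ℕ =>
      {e : EuclideanSpace ℝ (Fin m × Fin m) | 1 / ((n : ℝ) + 1) < krylovRatio e} :=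
    fun n k hnk e (he : 1 / ((n : ℝ) + 1) < krylovRatio e) =>
      show 1 / ((k : ℝ) + 1) < krylovRatio e from
        lt_of_le_of_lt (Nat.one_div_le_one_div hnk) he
  have ht := tendsto_measure_iUnion_atTop
    (μ := (limitLaw m : Measure (EuclideanSpace ℝ (Fin m × Fin m)))) hmono
  rw [← hU, limitLaw_krylovRatio_pos] at ht
  obtain ⟨n, hn⟩ := (ht.eventually (lt_mem_nhds ha)).exists
  exact ⟨1 / ((n : ℝ) + 1), by positivity, hn⟩

theorem mainTheorem9 (m : ℕ) (hm : 2 ≤ m)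
    {Ω : ℕ → Type*} [∀ d, MeasurableSpace (Ω d)] (P : ∀ d, Measure (Ω d))
    (W : ∀ d, Ω d → Matrix (Fin m) (Fin m) ℝ)
    (hW : ∀ d, HasLaw (W d) (wishartMeasure (1 : Matrix (Fin m) (Fin m) ℝ) d) (P d))
    (C : ℝ) (hC : 0 < C) :
    Tendsto (fun d => P d {ω | ∃ hA : (W d ω).IsHermitian, C < minEigengap hA})
      atTop (𝓝 1) := by
  have hP : ∀ d, IsProbabilityMeasure (P d) := fun d =>
    (hW d).isProbabilityMeasure_iff.2 (isProbabilityMeasure_wishartMeasure _ _)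
  refine tendsto_order.2 ⟨fun a ha => ?_, fun a ha =>
    Eventually.of_forall fun d => prob_le_one.trans_lt ha⟩
  obtain ⟨δ, hδ, haδ⟩ := exists_lt_limitLaw_krylovRatio m ha
  have hopen : IsOpen {e : EuclideanSpace ℝ (Fin m × Fin m) | δ < krylovRatio e} :=
    isOpen_lt continuous_const continuous_krylovRatio
  have hlim := haδ.trans_le
    (ProbabilityMeasure.le_liminf_measure_open_of_tendsto (tendsto_normalizedLaw m) hopen)
  have hsmall : Tendsto (fun d : ℕ => (m : ℝ) ^ m *
      2 ^ (Finset.univ.sigma fun i : Fin m => Finset.Ioi i).card * C * (√d)⁻¹) atTop (𝓝 0) := by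
    simpa using (tendsto_inv_atTop_zero.comp
      (Real.tendsto_sqrt_atTop.comp tendsto_natCast_atTop_atTop)).const_mul _
  filter_upwards [eventually_lt_of_lt_liminf hlim, hsmall.eventually (gt_mem_nhds hδ)] with d h1 h2
  refine h1.trans_le ?_
  rw [← wishartMeasure_map_center, ← (hW d).map_eq,
    AEMeasurable.map_map_of_aemeasurable (measurable_center d).aemeasurable (hW d).aemeasurable,
    Measure.map_apply_of_aemeasurable
      ((measurable_center d).comp_aemeasurable (hW d).aemeasurable) hopen.measurableSet]
  -- Monotonicity needs no measurability of the gap event.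
  refine measure_mono_ae ?_
  have hsymm := ae_isHermitian_wishartMeasure (1 : Matrix (Fin m) (Fin m) ℝ) d
  rw [← (hW d).map_eq] at hsymm
  filter_upwards [ae_of_ae_map (hW d).aemeasurable hsymm] with ω hω hδω
  have hA : (W d ω).IsHermitian := by
    ext i j
    simpa using hω j i
  refine ⟨hA, not_le.1 fun hle => ?_⟩
  exact absurd ((krylovRatio_center_le (d := d) hm hA hle).trans_lt h2) (not_lt.2 (le_of_lt hδω))
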